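/- Let $\kappa$ be an infinite cardinal. The class $\mathfrak{k}_\kappa$ is defined as follows. Its vocabulary has unary predicates $P,\Gamma,I,J$, binary predicates $R_1,R_2$, unary functions $F_i$ ($i\le\kappa$) and constants $c_i$ ($i<\kappa$). A structure $M$ belongs to $K_{\mathfrak{k}_\kappa}$ iff: * its universe is the disjoint union of $P^M$ (propositional variables), $\Gamma^M$ (sentences), $I^M$ (theories) and $J^M$ (truth assignments), and the $c_i^M$ are pairwise distinct elements of $P^M$; * for $i<\kappa$, $F_i^M:\Gamma^M\to P^M$, and $\Gamma^M$ is a set of sentences, each of one of the following four forms, the form and the constituents of $\varphi\in\Gamma^M$ being recorded by the $F_i=F_i^M(\varphi)$, so that different elements of $\Gamma^M$ are different sentences (have different sequences $\langle F_i^M(\varphi):i<\kappa\rangle$): * $\varphi=(p)$: $F_0=c_0$ and $F_i=p$ for $i\ge 1$; * $\varphi=(r\equiv p\wedge q)$: $F_0=c_1$, $F_1=p$, $F_2=q$ and $F_i=r$ for $i\ge 3$; * $\varphi=(q\equiv\neg p)$: $F_0=c_2$, $F_1=p$ and $F_i=q$ for $i\ge 2$; * $\varphi=(q\equiv\bigwedge_{j<\kappa}p_j)$: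 $F_0=c_3$, $F_1=q$ and $F_{2+j}=p_j$ for $j<\kappa$; here $p,q,r,p_j$ are arbitrary elements of $P^M$; * $R_1^M\subseteq\Gamma^M\times I^M$; for $t\in I^M$ let $\Gamma^M_t=\{\varphi\in\Gamma^M:\varphi\,R_1^M\,t\}$; * $R_2^M\subseteq(\Gamma^M\cup P^M)\times J^M$; each $s\in J^M$ gives the truth assignment $\mathcal{M}_s$ on $P^M$ in which $p$ is true iff $p\,R_2^M\,s$, and, for $\varphi\in\Gamma^M$, $\varphi\,R_2^M\,s$ iff $\varphi$ is true in $\mathcal{M}_s$; * $F_\kappa^M$ maps $J^M$ onto $I^M$, and $\mathcal{M}_s$ satisfies $\Gamma^M_{F_\kappa^M(s)}$ for every $s\in J^M$. The functions $F_i^M$ ($i<\kappa$) and $F_\kappa^M$ are the identity outside $\Gamma^M$ and $J^M$ respectively. For $M,N\in K_{\mathfrak{k}_\kappa}$, $M\le_{\mathfrak{k}_\kappa}N$ means that $M$ is a substructure of $N$. This is an abstract elementary class (a.e.c.). For an a.e.c. $\mathfrak{k}$ and $M\in K_{\mathfrak{k}}$, $\mathscr{S}^{<\omega}(M)$ is the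 set of types $\mathrm{tp}(\bar a,M,N)$, where $M\le_{\mathfrak{k}}N$ and $\bar a$ is a finite sequence of elements of $N$; equality of types over $M$ is the equivalence relation on the triples $(\bar a,M,N)$ generated by: $(\bar a_1,M,N_1)$ and $(\bar a_2,M,N_2)$ are related if some $\le_{\mathfrak{k}}$-embedding of $N_1$ into $N_2$ is the identity on $M$ and maps $\bar a_1$ to $\bar a_2$. For $M_0\le_{\mathfrak{k}}M$, $\mathrm{tp}(\bar a,M,N)\restriction M_0=\mathrm{tp}(\bar a,M_0,N)$. For a cardinal $\lambda$ and a regular cardinal $\theta$, $\mathfrak{k}$ is *$(\lambda,\theta)$-compact (for types)* if, whenever $\langle M_i:i\le\theta\rangle$ is $\le_{\mathfrak{k}}$-increasing continuous with $\|M_i\|\le\lambda$ for $i<\theta$, and $\mathbf{p}_i\in\mathscr{S}^{<\omega}(M_i)$ ($i<\theta$) satisfy $\mathbf{p}_i=\mathbf{p}_j\restriction M_i$ for $i<j<\theta$, there is $\mathbf{p}_\theta\in\mathscr{S}^{<\omega}(M_\theta)$ with $\mathbf{p}_\theta\restriction M_i=\mathbf{p}_i$ for all $i<\theta$. **Theorem.**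 Let $\theta>\kappa\ge\aleph_0$ with $\theta$ a regular cardinal such that there is no $\kappa^+$-complete uniform ultrafilter on $\theta$ (uniform: every member has cardinality $\theta$; $\kappa^+$-complete: closed under intersections of at most $\kappa$ members), and let $\lambda=2^\theta$. Then $\mathfrak{k}_\kappa$ is not $(\lambda,\theta)$-compact for types. -/

import Mathlib

open Cardinal Set FirstOrder FirstOrder.Language

universe u v w

/-! ## Abstract elementary classes

An a.e.c. `𝔨 = (K, ≤)` in the vocabulary `L` is presented by its class `K` of models and by its
`≤`-embeddings: `Strong f` says that `f : M → N` is an isomorphism of `M` onto some `M' ≤ N`. In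
particular `M ≤ N` for a substructure `M` of `N` is `Strong` of the inclusion map. -/

/-- Abstract elementary classes, with the usual axioms. -/
structure AEC (L : FirstOrder.Language.{v, w}) where
  /-- `M` belongs to the class `K`. -/
  Mem : ∀ (M : Type u) [L.Structure M], Prop
  /-- `f` is a `≤`-embedding. -/
  Strong : ∀ {M N : Type u} [L.Structure M] [L.Structure N], (M ↪[L] N) → Prop
  mem_left : ∀ {M N : Type u} [L.Structure M] [L.Structure N] (f : M ↪[L] N),
    Strong f → Mem M
  mem_right : ∀ {M N : Type u} [L.Structure M] [L.Structure N] (f : M ↪[L] N),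
    Strong f → Mem N
  /-- Closure under isomorphism; with `N = M` this is also reflexivity of `≤`. -/
  iso : ∀ {M N : Type u} [L.Structure M] [L.Structure N] (e : M ≃[L] N),
    Mem M → Mem N ∧ Strong e.toEmbedding
  /-- Transitivity. -/
  comp : ∀ {M N N' : Type u} [L.Structure M] [L.Structure N] [L.Structure N']
    (g : N ↪[L] N') (f : M ↪[L] N), Strong g → Strong f → Strong (g.comp f)
  /-- Coherence: if `M ⊆ N ≤ N'` and `M ≤ N'` then `M ≤ N`. -/
  coherence : ∀ {M N N' : Type u} [L.Structure M] [L.Structure N] [L.Structure N']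
    (g : N ↪[L] N') (f : M ↪[L] N), Strong g → Strong (g.comp f) → Strong f
  /-- The union of a `≤`-increasing chain is in `K`, is a `≤`-upper bound of the chain, and is `≤`
  every model of which all members of the chain are `≤`-submodels. -/
  union : ∀ {M : Type u} [L.Structure M] {ι : Type u} [LinearOrder ι] [WellFoundedLT ι]
    [Nonempty ι] (S : ι →o L.Substructure M),
    (∀ (i j : ι) (h : i ≤ j), Strong (Substructure.inclusion (S.monotone h))) →
    (∀ x : M, ∃ i, x ∈ S i) →
    Mem M ∧ (∀ i, Strong (S i).subtype) ∧
      ∀ {N : Type u} [L.Structure N] (f : M ↪[L] N),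
        (∀ i, Strong (f.comp (S i).subtype)) → Strong f
  /-- There is a Löwenheim–Skolem–Tarski number. -/
  exists_LST : ∃ χ : Cardinal.{u}, ℵ₀ ≤ χ ∧ ∀ (M : Type u) [L.Structure M], Mem M →
    ∀ A : Set M, ∃ S : L.Substructure M, A ⊆ S ∧ Strong S.subtype ∧ #S ≤ #A + χ

namespace AEC

section types

variable {L : FirstOrder.Language.{v, w}} (K : AEC.{u, v, w} L)

/-- A triple `(M, N, a)` with `M ≤ N` (up to renaming elements) and `a` a finite sequence of
elements of `N`. -/
structure PointedExt (M : Type u) [L.Structure M] where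
  carrier : Type u
  [str : L.Structure carrier]
  emb : M ↪[L] carrier
  strong : K.Strong emb
  tuple : List carrier

attribute [instance] PointedExt.str

/-- The basic step of equality of types: `N₁` embeds `≤`-ly into `N₂` over `M`, mapping `a₁` to
`a₂`. -/
def Step {M : Type u} [L.Structure M] (x y : K.PointedExt M) : Prop :=
  ∃ g : x.carrier ↪[L] y.carrier,
    K.Strong g ∧ g.comp x.emb = y.emb ∧ x.tuple.map g = y.tuple

/-- The set (here: a type) of orbital types of finite sequences over `M`: triples `(M, N, a)`
modulo the equivalence relation generated by `Step`, that is, two triples are identified when they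
are connected by a finite zigzag of `≤`-embeddings over `M` respecting the sequences. No
amalgamation is assumed. -/
def FinType (M : Type u) [L.Structure M] :=
  Quot (K.Step (M := M))

/-- The orbital type `tp(a, M, N)`. -/
def tp {M : Type u} [L.Structure M] (x : K.PointedExt M) : K.FinType M :=
  Quot.mk _ x

/-- The triple `(M₀, N, a)` obtained from `(M, N, a)` when `M₀ ≤ M`. -/
def PointedExt.restrict {K : AEC.{u, v, w} L} {M₀ M : Type u} [L.Structure M₀] [L.Structure M]
    (h : M₀ ↪[L] M) (hh : K.Strong h) (x : K.PointedExt M) : K.PointedExt M₀ where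
  carrier := x.carrier
  emb := x.emb.comp h
  strong := K.comp _ _ x.strong hh
  tuple := x.tuple

/-- Restriction of types: `tp(a, M, N) ↾ M₀ = tp(a, M₀, N)`. -/
def restrict {M₀ M : Type u} [L.Structure M₀] [L.Structure M]
    (h : M₀ ↪[L] M) (hh : K.Strong h) : K.FinType M → K.FinType M₀ :=
  Quot.map (PointedExt.restrict h hh) (by
    rintro x y ⟨g, hg, h1, h2⟩
    refine ⟨g, hg, ?_, h2⟩
    change g.comp (x.emb.comp h) = y.emb.comp h
    rw [← h1, Embedding.comp_assoc])

/-- A `≤`-increasing continuous sequence `⟨M_i : i ≤ δ⟩`; the models are substructures of a common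
structure. -/
structure Chain (δ : Ordinal.{u}) where
  carrier : Type u
  [str : L.Structure carrier]
  sub : Set.Iic δ →o L.Substructure carrier
  strong : ∀ (i j : Set.Iic δ) (h : i ≤ j), K.Strong (Substructure.inclusion (sub.monotone h))
  continuous : ∀ i : Set.Iic δ, Order.IsSuccLimit (i : Ordinal.{u}) →
    ∀ x ∈ sub i, ∃ j < i, x ∈ sub j

attribute [instance] Chain.str

variable {K} in
/-- The model `M_i` of the sequence. -/
abbrev Chain.model {δ : Ordinal.{u}} (C : K.Chain δ) (i : Ordinal.{u}) (hi : i ≤ δ) : Type u :=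
  C.sub ⟨i, hi⟩

variable {K} in
/-- Restriction of a type over `M_j` to `M_i`, for `i ≤ j`. -/
def Chain.restrict {δ : Ordinal.{u}} (C : K.Chain δ) {i j : Ordinal.{u}} (hij : i ≤ j)
    (hj : j ≤ δ) : K.FinType (C.model j hj) → K.FinType (C.model i (hij.trans hj)) :=
  K.restrict _ (C.strong ⟨i, hij.trans hj⟩ ⟨j, hj⟩ hij)

/-- `(≤ lam, μ)`-compactness for types, also called `(lam, μ)`-compactness: for every
`≤`-increasing continuous `⟨M_i : i ≤ μ⟩` with `‖M_i‖ ≤ lam` for `i < μ`, every coherent sequence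
of types `p_i` over `M_i` (`i < μ`) has an extension over `M_μ`. -/
def IsCompactForTypes (lam μ : Cardinal.{u}) : Prop :=
  ∀ C : K.Chain μ.ord,
    (∀ (i : Ordinal.{u}) (hi : i < μ.ord), #(C.model i hi.le) ≤ lam) →
    ∀ p : ∀ (i : Ordinal.{u}) (hi : i < μ.ord), K.FinType (C.model i hi.le),
      (∀ (i j : Ordinal.{u}) (hij : i < j) (hj : j < μ.ord),
        p i (hij.trans hj) = C.restrict hij.le hj.le (p j hj)) →
      ∃ q : K.FinType (C.model μ.ord le_rfl),
        ∀ (i : Ordinal.{u}) (hi : i < μ.ord), C.restrict hi.le le_rfl q = p i hi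

end types

end AEC

/-! ## The class `𝔨_κ` of models coding propositional theories -/

namespace PropAEC

/-- The four sorts: propositional variables, sentences, (indices of) theories, (indices of) truth
assignments. -/
inductive Kind : Type
  | P | Γ | I | J

/-- Function symbols: unary `F_i` for `i < κ`, the unary `F_κ`, and constants `c_i` for `i < κ`. -/
inductive Func (κ : Cardinal.{u}) : ℕ → Type u
  | F : κ.ord.ToType → Func κ 1
  | Fκ : Func κ 1
  | c : κ.ord.ToType → Func κ 0

/-- Predicates: the unary `P, Γ, I, J` and the binary `R₁, R₂`. -/
inductive Rel : ℕ → Type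
  | kind : Kind → Rel 1
  | R₁ : Rel 2
  | R₂ : Rel 2

/-- The vocabulary of `𝔨_κ`. -/
def lang (κ : Cardinal.{u}) : FirstOrder.Language.{u, 0} where
  Functions := Func κ
  Relations := Rel

section symbols

variable (κ : Cardinal.{u}) {M : Type u} [(lang κ).Structure M]

/-- `x` is of the sort `k`. -/
def Is (k : Kind) (x : M) : Prop :=
  Structure.RelMap (L := lang κ) (Rel.kind k) ![x]

/-- `φ` belongs to the theory `t`. -/
def R₁ (φ t : M) : Prop :=
  Structure.RelMap (L := lang κ) Rel.R₁ ![φ, t]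

/-- The variable or sentence `x` is true in the truth assignment `s`. -/
def R₂ (x s : M) : Prop :=
  Structure.RelMap (L := lang κ) Rel.R₂ ![x, s]

variable {κ} in
/-- `F_i`, for `i < κ`. -/
def F (i : κ.ord.ToType) (x : M) : M :=
  Structure.funMap (L := lang κ) (Func.F i) ![x]

/-- `F_κ`. -/
def Fκ (x : M) : M :=
  Structure.funMap (L := lang κ) (Func.Fκ : Func κ 1) ![x]

variable {κ} (M) in
/-- The constant `c_i`, for `i < κ`. -/
def c (i : κ.ord.ToType) : M :=
  Structure.funMap (L := lang κ) (Func.c i) ![]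

end symbols

section sentences

variable {κ : Cardinal.{u}} (hκ : ℵ₀ ≤ κ) {M : Type u} [(lang κ).Structure M]

/-- The finite ordinal `n`, as an index below the infinite cardinal `κ`. -/
noncomputable def idx (n : ℕ) : κ.ord.ToType :=
  Ordinal.ToType.mk ⟨(n : Ordinal.{u}),
    (Ordinal.natCast_lt_omega0 n).trans_le (Cardinal.omega0_le_ord.2 hκ)⟩

/-- `φ` codes the sentence `(p)`. -/
def CodesVar (φ p : M) : Prop :=
  F (idx hκ 0) φ = c M (idx hκ 0) ∧ ∀ i, idx hκ 1 ≤ i → F i φ = p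

/-- `φ` codes the sentence `(r ≡ p ∧ q)`. -/
def CodesAnd (φ r p q : M) : Prop :=
  F (idx hκ 0) φ = c M (idx hκ 1) ∧ F (idx hκ 1) φ = p ∧ F (idx hκ 2) φ = q ∧
    ∀ i, idx hκ 3 ≤ i → F i φ = r

/-- `φ` codes the sentence `(q ≡ ¬ p)`. -/
def CodesNot (φ q p : M) : Prop :=
  F (idx hκ 0) φ = c M (idx hκ 2) ∧ F (idx hκ 1) φ = p ∧ ∀ i, idx hκ 2 ≤ i → F i φ = q

/-- `φ` codes the sentence `(q ≡ ⋀ p_i)`; the `κ` conjuncts `p_i` are indexed by the ordinals `i`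
with `2 ≤ i < κ`, so that they are the values `F_i(φ)` for these `i`. -/
def CodesConj (φ q : M) (p : {i : κ.ord.ToType // idx hκ 2 ≤ i} → M) : Prop :=
  F (idx hκ 0) φ = c M (idx hκ 3) ∧ F (idx hκ 1) φ = q ∧ ∀ i, F i.1 φ = p i

end sentences

/-- `M` is a model in the class `𝔨_κ`. The functions `F_i` (on `Γ`) and `F_κ` (on `J`) are partial
in the mathematical text; outside their domains they are the identity here. -/
structure IsModel (κ : Cardinal.{u}) (hκ : ℵ₀ ≤ κ) (M : Type u) [(lang κ).Structure M] :
    Prop where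
  /-- The universe is the disjoint union of `P, Γ, I, J`. -/
  partition : ∀ x : M, ∃! k : Kind, Is κ k x
  c_mem : ∀ i, Is κ .P (c (κ := κ) M i)
  c_inj : Function.Injective (c (κ := κ) M)
  F_mem : ∀ i (φ : M), Is κ .Γ φ → Is κ .P (F (κ := κ) i φ)
  F_off : ∀ i (x : M), ¬ Is κ .Γ x → F (κ := κ) i x = x
  /-- Every element of `Γ` is a sentence of one of the four forms. -/
  form : ∀ φ : M, Is κ .Γ φ →
    (∃ p, CodesVar hκ φ p) ∨ (∃ r p q, CodesAnd hκ φ r p q) ∨ (∃ q p, CodesNot hκ φ q p) ∨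
      ∃ q p, CodesConj hκ φ q p
  /-- Different elements of `Γ` are different sentences. -/
  ext : ∀ φ ψ : M, Is κ .Γ φ → Is κ .Γ ψ → (∀ i, F (κ := κ) i φ = F i ψ) → φ = ψ
  R₁_sub : ∀ φ t : M, R₁ κ φ t → Is κ .Γ φ ∧ Is κ .I t
  R₂_sub : ∀ x s : M, R₂ κ x s → (Is κ .Γ x ∨ Is κ .P x) ∧ Is κ .J s
  /-- `R₂` on sentences is computed from the truth values `R₂` of the variables. -/
  true_var : ∀ φ s p : M, Is κ .Γ φ → Is κ .J s → CodesVar hκ φ p → (R₂ κ φ s ↔ R₂ κ p s)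
  true_and : ∀ φ s r p q : M, Is κ .Γ φ → Is κ .J s → CodesAnd hκ φ r p q →
    (R₂ κ φ s ↔ (R₂ κ r s ↔ R₂ κ p s ∧ R₂ κ q s))
  true_not : ∀ φ s q p : M, Is κ .Γ φ → Is κ .J s → CodesNot hκ φ q p →
    (R₂ κ φ s ↔ (R₂ κ q s ↔ ¬ R₂ κ p s))
  true_conj : ∀ (φ s q : M) (p : {i : κ.ord.ToType // idx hκ 2 ≤ i} → M),
    Is κ .Γ φ → Is κ .J s → CodesConj hκ φ q p →
    (R₂ κ φ s ↔ (R₂ κ q s ↔ ∀ i, R₂ κ (p i) s))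
  Fκ_mem : ∀ s : M, Is κ .J s → Is κ .I (Fκ κ s)
  Fκ_off : ∀ x : M, ¬ Is κ .J x → Fκ κ x = x
  /-- The truth assignment `s` satisfies the theory `F_κ(s)`. -/
  models : ∀ s φ : M, Is κ .J s → R₁ κ φ (Fκ κ s) → R₂ κ φ s
  /-- Every theory `t ∈ I` is `F_κ(s)` for some `s ∈ J`. -/
  onto : ∀ t : M, Is κ .I t → ∃ s : M, Is κ .J s ∧ Fκ κ s = t

section lemmas

variable {κ : Cardinal.{u}} {hκ : ℵ₀ ≤ κ} {M N : Type u} [(lang κ).Structure M]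
  [(lang κ).Structure N] (f : M ↪[lang κ] N)

theorem is_map (k : Kind) (x : M) : Is κ k (f x) ↔ Is κ k x := by
  have := f.map_rel (Rel.kind k : (lang κ).Relations 1) ![x]
  rw [show (f ∘ ![x] : Fin 1 → N) = ![f x] by ext i; fin_cases i; rfl] at this
  exact this

theorem R₁_map (x y : M) : R₁ κ (f x) (f y) ↔ R₁ κ x y := by
  have := f.map_rel (Rel.R₁ : (lang κ).Relations 2) ![x, y]
  rw [show (f ∘ ![x, y] : Fin 2 → N) = ![f x, f y] by ext i; fin_cases i <;> rfl] at this
  exact this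

theorem R₂_map (x y : M) : R₂ κ (f x) (f y) ↔ R₂ κ x y := by
  have := f.map_rel (Rel.R₂ : (lang κ).Relations 2) ![x, y]
  rw [show (f ∘ ![x, y] : Fin 2 → N) = ![f x, f y] by ext i; fin_cases i <;> rfl] at this
  exact this

theorem F_map (i : κ.ord.ToType) (x : M) : F i (f x) = f (F i x) := by
  have := f.map_fun (Func.F i : (lang κ).Functions 1) ![x]
  rw [show (f ∘ ![x] : Fin 1 → N) = ![f x] by ext i; fin_cases i; rfl] at this
  exact this.symm

theorem Fκ_map (x : M) : Fκ κ (f x) = f (Fκ κ x) := by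
  have := f.map_fun (Func.Fκ : (lang κ).Functions 1) ![x]
  rw [show (f ∘ ![x] : Fin 1 → N) = ![f x] by ext i; fin_cases i; rfl] at this
  exact this.symm

theorem c_map (i : κ.ord.ToType) : c N i = f (c M i) := by
  have := f.map_fun (Func.c i : (lang κ).Functions 0) ![]
  simpa [c, Matrix.empty_eq] using this.symm

theorem codesVar_map (φ p : M) : CodesVar hκ (f φ) (f p) ↔ CodesVar hκ φ p := by
  simp only [CodesVar, F_map, c_map f, f.injective.eq_iff]

theorem codesAnd_map (φ r p q : M) :
    CodesAnd hκ (f φ) (f r) (f p) (f q) ↔ CodesAnd hκ φ r p q := by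
  simp only [CodesAnd, F_map, c_map f, f.injective.eq_iff]

theorem codesNot_map (φ q p : M) : CodesNot hκ (f φ) (f q) (f p) ↔ CodesNot hκ φ q p := by
  simp only [CodesNot, F_map, c_map f, f.injective.eq_iff]

theorem codesConj_map (φ q : M) (p : {i : κ.ord.ToType // idx hκ 2 ≤ i} → M) :
    CodesConj hκ (f φ) (f q) (fun i => f (p i)) ↔ CodesConj hκ φ q p := by
  simp only [CodesConj, F_map, c_map f, f.injective.eq_iff]

theorem form_iff (φ : M) :
    ((∃ p, CodesVar hκ φ p) ∨ (∃ r p q, CodesAnd hκ φ r p q) ∨ (∃ q p, CodesNot hκ φ q p) ∨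
      ∃ q p, CodesConj hκ φ q p) ↔
    (CodesVar hκ φ (F (idx hκ 1) φ) ∨
      CodesAnd hκ φ (F (idx hκ 3) φ) (F (idx hκ 1) φ) (F (idx hκ 2) φ) ∨
      CodesNot hκ φ (F (idx hκ 2) φ) (F (idx hκ 1) φ) ∨
      CodesConj hκ φ (F (idx hκ 1) φ) (fun i => F i.1 φ)) := by
  constructor
  · rintro (⟨p, h⟩ | ⟨r, p, q, h⟩ | ⟨q, p, h⟩ | ⟨q, p, h⟩)
    · left; rw [h.2 _ le_rfl]; exact h
    · right; left; rw [h.2.1, h.2.2.1, h.2.2.2 _ le_rfl]; exact h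
    · right; right; left; rw [h.2.1, h.2.2 _ le_rfl]; exact h
    · right; right; right; exact ⟨h.1, rfl, fun _ => rfl⟩
  · rintro (h | h | h | h)
    · exact Or.inl ⟨_, h⟩
    · exact Or.inr (Or.inl ⟨_, _, _, h⟩)
    · exact Or.inr (Or.inr (Or.inl ⟨_, _, h⟩))
    · exact Or.inr (Or.inr (Or.inr ⟨_, _, h⟩))

/-- A structure embedded into a model of `𝔨_κ` is a model of `𝔨_κ` if it contains, for each of its
theories, a truth assignment for that theory. -/
theorem IsModel.of_embedding (f : M ↪[lang κ] N) (h : IsModel κ hκ N)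
    (honto : ∀ t : M, Is κ .I t → ∃ s : M, Is κ .J s ∧ Fκ κ s = t) : IsModel κ hκ M where
  partition x := by simpa only [is_map] using h.partition (f x)
  c_mem i := by rw [← is_map f, ← c_map f]; exact h.c_mem i
  c_inj i j hij := h.c_inj (by rw [c_map f, c_map f, hij])
  F_mem i φ hφ := by
    rw [← is_map f, ← F_map f]; exact h.F_mem i _ ((is_map f _ _).2 hφ)
  F_off i x hx := f.injective (by
    rw [← F_map f]; exact h.F_off i _ (fun h' => hx ((is_map f _ _).1 h')))
  form φ hφ := by
    have := h.form (f φ) ((is_map f _ _).2 hφ)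
    rw [form_iff] at this ⊢
    simpa only [F_map, codesVar_map, codesAnd_map, codesNot_map, codesConj_map] using this
  ext φ ψ hφ hψ hh := f.injective (h.ext _ _ ((is_map f _ _).2 hφ) ((is_map f _ _).2 hψ)
    (fun i => by rw [F_map f, F_map f, hh i]))
  R₁_sub φ t ht := by simpa only [is_map] using h.R₁_sub (f φ) (f t) ((R₁_map f _ _).2 ht)
  R₂_sub φ t ht := by simpa only [is_map] using h.R₂_sub (f φ) (f t) ((R₂_map f _ _).2 ht)
  true_var φ s p hφ hs hc := by
    simpa only [R₂_map] using h.true_var (f φ) (f s) (f p) ((is_map f _ _).2 hφ)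
      ((is_map f _ _).2 hs) ((codesVar_map f _ _).2 hc)
  true_and φ s r p q hφ hs hc := by
    simpa only [R₂_map] using h.true_and (f φ) (f s) (f r) (f p) (f q) ((is_map f _ _).2 hφ)
      ((is_map f _ _).2 hs) ((codesAnd_map f _ _ _ _).2 hc)
  true_not φ s q p hφ hs hc := by
    simpa only [R₂_map] using h.true_not (f φ) (f s) (f q) (f p) ((is_map f _ _).2 hφ)
      ((is_map f _ _).2 hs) ((codesNot_map f _ _ _).2 hc)
  true_conj φ s q p hφ hs hc := by
    simpa only [R₂_map] using h.true_conj (f φ) (f s) (f q) (fun i => f (p i))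
      ((is_map f _ _).2 hφ) ((is_map f _ _).2 hs) ((codesConj_map f _ _ _).2 hc)
  Fκ_mem s hs := by
    rw [← is_map f, ← Fκ_map f]; exact h.Fκ_mem _ ((is_map f _ _).2 hs)
  Fκ_off x hx := f.injective (by
    rw [← Fκ_map f]; exact h.Fκ_off _ (fun h' => hx ((is_map f _ _).1 h')))
  models s φ hs hφ := by
    rw [← R₂_map f]
    exact h.models _ _ ((is_map f _ _).2 hs) (by rw [Fκ_map f, R₁_map f]; exact hφ)
  onto := honto

theorem IsModel.of_equiv (e : M ≃[lang κ] N) (h : IsModel κ hκ M) : IsModel κ hκ N := by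
  refine IsModel.of_embedding e.symm.toEmbedding h fun t ht => ?_
  obtain ⟨s, hs, hst⟩ := h.onto (e.symm.toEmbedding t) ((is_map e.symm.toEmbedding _ _).2 ht)
  refine ⟨e.toEmbedding s, (is_map e.toEmbedding _ _).2 hs, ?_⟩
  rw [Fκ_map, hst]
  exact e.apply_symm_apply t

/-- The union of a chain of models of `𝔨_κ` is a model of `𝔨_κ`. -/
theorem IsModel.of_union {ι : Type u} [LinearOrder ι] [Nonempty ι]
    (S : ι →o (lang κ).Substructure M) (hS : ∀ i, IsModel κ hκ (S i))
    (hcov : ∀ x : M, ∃ i, x ∈ S i) : IsModel κ hκ M := by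
  have one : ∀ x : M, ∃ i, ∃ x' : S i, (S i).subtype x' = x := fun x => by
    obtain ⟨i, hi⟩ := hcov x
    exact ⟨i, ⟨x, hi⟩, rfl⟩
  have two : ∀ x y : M, ∃ i, ∃ x' y' : S i, (S i).subtype x' = x ∧ (S i).subtype y' = y :=
    fun x y => by
    obtain ⟨i, hi⟩ := hcov x
    obtain ⟨j, hj⟩ := hcov y
    exact ⟨max i j, ⟨x, S.monotone (le_max_left i j) hi⟩, ⟨y, S.monotone (le_max_right i j) hj⟩,
      rfl, rfl⟩
  refine ⟨?_, ?_, ?_, ?_, ?_, ?_, ?_, ?_, ?_, ?_, ?_, ?_, ?_, ?_, ?_, ?_, ?_⟩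
  · intro x
    obtain ⟨i, x, rfl⟩ := one x
    simpa only [is_map] using (hS i).partition x
  · intro j
    obtain ⟨i⟩ := ‹Nonempty ι›
    rw [c_map (S i).subtype, is_map]
    exact (hS i).c_mem j
  · intro j k hjk
    obtain ⟨i⟩ := ‹Nonempty ι›
    rw [c_map (S i).subtype, c_map (S i).subtype] at hjk
    exact (hS i).c_inj ((S i).subtype.injective hjk)
  · intro j x hx
    obtain ⟨i, x, rfl⟩ := one x
    rw [is_map] at hx
    rw [F_map, is_map]
    exact (hS i).F_mem j x hx
  · intro j x hx
    obtain ⟨i, x, rfl⟩ := one x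
    rw [is_map] at hx
    rw [F_map, (hS i).F_off j x hx]
  · intro x hx
    obtain ⟨i, x, rfl⟩ := one x
    rw [is_map] at hx
    have := (hS i).form x hx
    rw [form_iff] at this ⊢
    simpa only [F_map, codesVar_map, codesAnd_map, codesNot_map, codesConj_map] using this
  · intro x y hx hy h
    obtain ⟨i, x, y, rfl, rfl⟩ := two x y
    rw [is_map] at hx hy
    simp only [F_map, (S i).subtype.injective.eq_iff] at h
    rw [(hS i).ext x y hx hy h]
  · intro x y h
    obtain ⟨i, x, y, rfl, rfl⟩ := two x y
    rw [R₁_map] at h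
    simpa only [is_map] using (hS i).R₁_sub x y h
  · intro x y h
    obtain ⟨i, x, y, rfl, rfl⟩ := two x y
    rw [R₂_map] at h
    simpa only [is_map] using (hS i).R₂_sub x y h
  · intro x y p hx hy h
    obtain ⟨i, x, y, rfl, rfl⟩ := two x y
    rw [is_map] at hx hy
    obtain rfl : (S i).subtype (F (idx hκ 1) x) = p := by rw [← F_map, h.2 _ le_rfl]
    rw [codesVar_map] at h
    simpa only [R₂_map] using (hS i).true_var x y _ hx hy h
  · intro x y r p q hx hy h
    obtain ⟨i, x, y, rfl, rfl⟩ := two x y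
    rw [is_map] at hx hy
    obtain rfl : (S i).subtype (F (idx hκ 1) x) = p := by rw [← F_map, h.2.1]
    obtain rfl : (S i).subtype (F (idx hκ 2) x) = q := by rw [← F_map, h.2.2.1]
    obtain rfl : (S i).subtype (F (idx hκ 3) x) = r := by rw [← F_map, h.2.2.2 _ le_rfl]
    rw [codesAnd_map] at h
    simpa only [R₂_map] using (hS i).true_and x y _ _ _ hx hy h
  · intro x y q p hx hy h
    obtain ⟨i, x, y, rfl, rfl⟩ := two x y
    rw [is_map] at hx hy
    obtain rfl : (S i).subtype (F (idx hκ 1) x) = p := by rw [← F_map, h.2.1]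
    obtain rfl : (S i).subtype (F (idx hκ 2) x) = q := by rw [← F_map, h.2.2 _ le_rfl]
    rw [codesNot_map] at h
    simpa only [R₂_map] using (hS i).true_not x y _ _ hx hy h
  · intro x y q p hx hy h
    obtain ⟨i, x, y, rfl, rfl⟩ := two x y
    rw [is_map] at hx hy
    obtain rfl : (S i).subtype (F (idx hκ 1) x) = q := by rw [← F_map, h.2.1]
    obtain rfl : (fun j => (S i).subtype (F j.1 x)) = p := by
      funext j; rw [← F_map, h.2.2 j]
    rw [codesConj_map] at h
    simpa only [R₂_map] using (hS i).true_conj x y _ _ hx hy h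
  · intro x hx
    obtain ⟨i, x, rfl⟩ := one x
    rw [is_map] at hx
    rw [Fκ_map, is_map]
    exact (hS i).Fκ_mem x hx
  · intro x hx
    obtain ⟨i, x, rfl⟩ := one x
    rw [is_map] at hx
    rw [Fκ_map, (hS i).Fκ_off x hx]
  · intro x y hx h
    obtain ⟨i, x, y, rfl, rfl⟩ := two x y
    rw [is_map] at hx
    rw [Fκ_map, R₁_map] at h
    rw [R₂_map]
    exact (hS i).models x y hx h
  · intro x hx
    obtain ⟨i, x, rfl⟩ := one x
    rw [is_map] at hx
    obtain ⟨s, hs, hst⟩ := (hS i).onto x hx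
    exact ⟨(S i).subtype s, (is_map _ _ _).2 hs, by rw [Fκ_map, hst]⟩

theorem card_functions_le (hκ : ℵ₀ ≤ κ) : #(Σ n, (lang κ).Functions n) ≤ κ := by
  let e : (Σ n, Func κ n) → (κ.ord.ToType ⊕ Unit) ⊕ κ.ord.ToType := fun x =>
    match x with
    | ⟨_, .F i⟩ => .inl (.inl i)
    | ⟨_, .Fκ⟩ => .inl (.inr ())
    | ⟨_, .c i⟩ => .inr i
  have he : Function.Injective e := by
    rintro ⟨_, _ | _ | _⟩ ⟨_, _ | _ | _⟩ h <;> simp_all [e]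
  refine (Cardinal.mk_le_of_injective he).trans ?_
  have h1 : (1 : Cardinal.{u}) ≤ κ := Cardinal.one_le_aleph0.trans hκ
  simp only [Cardinal.mk_sum, Cardinal.mk_ord_toType, Cardinal.lift_id, Cardinal.lift_uzero,
    Cardinal.mk_fintype, Fintype.card_unit, Nat.cast_one, Cardinal.lift_one]
  rw [Cardinal.add_eq_left hκ h1, Cardinal.add_eq_self hκ]

/-- The Löwenheim–Skolem–Tarski property of `𝔨_κ`. -/
theorem IsModel.exists_small (h : IsModel κ hκ M) (A : Set M) :
    ∃ S : (lang κ).Substructure M, A ⊆ S ∧ IsModel κ hκ S ∧ #S ≤ #A + κ := by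
  classical
  have hw : ∀ t : M, ∃ s : M, Is κ .I t → Is κ .J s ∧ Fκ κ s = t := fun t => by
    by_cases ht : Is κ .I t
    · obtain ⟨s, hs⟩ := h.onto t ht
      exact ⟨s, fun _ => hs⟩
    · exact ⟨t, fun h' => absurd h' ht⟩
  choose W hW using hw
  let A₁ : (lang κ).Substructure M := Substructure.closure (lang κ) A
  let B : Set M := W '' {t | t ∈ A₁ ∧ Is κ .I t}
  have hB : ∀ x ∈ B, Is κ .J x ∧ Fκ κ x ∈ A₁ := by
    rintro _ ⟨t, ⟨ht, hI⟩, rfl⟩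
    obtain ⟨h1, h2⟩ := hW t hI
    exact ⟨h1, by rw [h2]; exact ht⟩
  let S : (lang κ).Substructure M :=
    { carrier := (A₁ : Set M) ∪ B
      fun_mem := by
        intro n g x hx
        cases g with
        | F i =>
          have hx0 : x = ![x 0] := by ext j; fin_cases j; rfl
          rcases hx 0 with h0 | h0
          · exact Or.inl (A₁.fun_mem (Func.F i : (lang κ).Functions 1) x (fun j => by
              fin_cases j; exact h0))
          · have hn : ¬ Is κ .Γ (x 0) := fun hΓ => by
              have := (h.partition (x 0)).unique hΓ (hB _ h0).1
              cases this
            have := h.F_off i (x 0) hn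
            rw [hx0]
            change F i (x 0) ∈ _
            rw [this]
            exact Or.inr h0
        | Fκ =>
          have hx0 : x = ![x 0] := by ext j; fin_cases j; rfl
          rcases hx 0 with h0 | h0
          · exact Or.inl (A₁.fun_mem (Func.Fκ : (lang κ).Functions 1) x (fun j => by
              fin_cases j; exact h0))
          · rw [hx0]
            exact Or.inl (hB _ h0).2
        | c i =>
          exact Or.inl (A₁.fun_mem (Func.c i : (lang κ).Functions 0) x (fun j => j.elim0)) }
  have hAS : A ⊆ S := fun x hx => Or.inl (Substructure.subset_closure hx)
  refine ⟨S, hAS, IsModel.of_embedding S.subtype h ?_, ?_⟩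
  · rintro ⟨t, ht⟩ hI
    have hI' : Is κ .I t := (is_map S.subtype _ ⟨t, ht⟩).2 hI
    have htA : t ∈ A₁ := by
      rcases ht with ht | ht
      · exact ht
      · have := (h.partition t).unique hI' (hB _ ht).1
        cases this
    obtain ⟨h1, h2⟩ := hW t hI'
    have hWS : W t ∈ S := Or.inr ⟨t, ⟨htA, hI'⟩, rfl⟩
    refine ⟨⟨W t, hWS⟩, (is_map S.subtype _ ⟨W t, hWS⟩).1 h1, S.subtype.injective ?_⟩
    rw [← Fκ_map]
    exact h2
  · have hA₁ : #A₁ ≤ #A + κ := by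
      have := Substructure.lift_card_closure_le (L := lang κ) (s := A)
      simp only [Cardinal.lift_id] at this
      refine this.trans (max_le (hκ.trans (self_le_add_left _ _)) ?_)
      gcongr
      exact card_functions_le hκ
    have hBc : #B ≤ #A₁ :=
      Cardinal.mk_image_le.trans (Cardinal.mk_le_mk_of_subset fun x hx => hx.1)
    have hinf : ℵ₀ ≤ #A + κ := hκ.trans (self_le_add_left _ _)
    calc #S = #((A₁ : Set M) ∪ B : Set M) := rfl
      _ ≤ #A₁ + #B := Cardinal.mk_union_le _ _
      _ ≤ (#A + κ) + (#A + κ) := add_le_add hA₁ (hBc.trans hA₁)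
      _ = #A + κ := Cardinal.add_eq_self hinf

end lemmas

/-- The abstract elementary class `𝔨_κ`; here `M ≤ N` means that `M` is a substructure of `N` and
both are in the class. -/
def frakK (κ : Cardinal.{u}) (hκ : ℵ₀ ≤ κ) : AEC.{u, u, 0} (lang κ) where
  Mem M _ := IsModel κ hκ M
  Strong {M N} _ _ _ := IsModel κ hκ M ∧ IsModel κ hκ N
  mem_left _ h := h.1
  mem_right _ h := h.2
  iso e h := ⟨h.of_equiv e, h, h.of_equiv e⟩
  comp _ _ hg hf := ⟨hf.1, hg.2⟩
  coherence _ _ hg hgf := ⟨hgf.1, hg.1⟩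
  union S hS hcov := by
    have hS' := fun i => (hS i i le_rfl).1
    have hM := IsModel.of_union S hS' hcov
    exact ⟨hM, fun i => ⟨hS' i, hM⟩, fun _ hf => ⟨hM, (hf (Classical.arbitrary _)).2⟩⟩
  exists_LST := ⟨κ, hκ, fun M _ h A => by
    obtain ⟨S, h1, h2, h3⟩ := h.exists_small A
    exact ⟨S, h1, ⟨h2, h⟩, h3⟩⟩

end PropAEC

/-- The ultrafilter `D` on `X` is uniform: all its members have the cardinality of `X`. -/
def Ultrafilter.IsUniform {X : Type u} (D : Ultrafilter X) : Prop :=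
  ∀ A ∈ D, #A = #X

/-!
Take every subset `A` of `θ` as a variable, true at the assignment `x ∈ θ` iff `x ∈ A`, and let
`M_i` consist of all variables together with the sentences true on a final segment `[k, θ)` for
some `k < i`. The assignments `x ≥ i` satisfy all sentences of `M_i`, so there is an extension with
a theory consisting of all of them; let `p_i` be the type of this theory over `M_i`. For `i < j`
the extension by the assignments `x ≥ j` alone realises both `p_i` and `p_j ↾ M_i`, so these types
cohere.

A common extension of the `p_i` is the type of a theory containing all sentences of `M_θ`. As `F_κ`
is onto, some truth assignment satisfies that theory; let `D` be the family of subsets of `θ` which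
it makes true. The sentences `(Aᶜ ≡ ¬ A)` and `(⋂ A_j ≡ ⋀ A_j)` make `D` a `κ⁺`-complete
ultrafilter, and the sentences `([k, θ))` put all final segments of `θ` into `D`, so `D` is uniform
because `θ` is regular.
-/

theorem exists_ultrafilter_cardinalInterFilter_of_iInter_mem_iff {ι X : Type u} [Nontrivial ι]
    (D : Set (Set X)) (hcompl : ∀ A, Aᶜ ∈ D ↔ A ∉ D)
    (hiInter : ∀ A : ι → Set X, ⋂ i, A i ∈ D ↔ ∀ i, A i ∈ D) :
    ∃ U : Ultrafilter X, (∀ A, A ∈ U ↔ A ∈ D) ∧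
      CardinalInterFilter (U : Filter X) (Order.succ #ι) := by
  have hsInter : ∀ S : Set (Set X), S.Nonempty → #S ≤ #ι → (⋂₀ S ∈ D ↔ ∀ A ∈ S, A ∈ D) := by
    rintro S hS ⟨f⟩
    have := hS.to_subtype
    have hg : Function.Surjective (Function.invFun f) := Function.invFun_surjective f.injective
    rw [sInter_eq_iInter, ← hg.iInter_comp, hiInter, ← hg.forall (p := fun A => A.1 ∈ D),
      Subtype.forall]
  have hinter : ∀ A B, A ∩ B ∈ D ↔ A ∈ D ∧ B ∈ D := fun A B => by
    have hpair : #({A, B} : Set (Set X)) ≤ #ι :=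
      (mk_insert_le.trans_eq (by rw [mk_singleton, one_add_one_eq_two])).trans
        (two_le_iff.2 (exists_pair_ne ι))
    simpa using hsInter {A, B} (insert_nonempty _ _) hpair
  have hempty : ∅ ∉ D := fun h => by
    have huniv : Set.univ ∈ D := ((hinter ∅ Set.univ).1 (by rwa [empty_inter])).2
    exact (hcompl ∅).1 (by rwa [compl_empty]) h
  let G : Filter X :=
    { sets := D
      univ_sets := by rwa [← compl_empty, hcompl]
      sets_of_superset := fun {A B} hA hAB =>
        ((hinter A B).1 (by rwa [inter_eq_self_of_subset_left hAB])).2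
      inter_sets := fun {A B} hA hB => (hinter A B).2 ⟨hA, hB⟩ }
  refine ⟨Ultrafilter.ofComplNotMemIff G fun A => (hcompl A).not.trans not_not,
    fun _ => Iff.rfl, ⟨fun S hS hSD => ?_⟩⟩
  rcases S.eq_empty_or_nonempty with rfl | hne
  · exact sInter_empty ▸ G.univ_sets
  · exact (hsInter S hne (Order.lt_succ_iff.1 hS)).2 hSD

theorem isUniform_of_forall_Ici_mem {X : Type u} [Preorder X] (hX : #X ≤ Order.cof X)
    (U : Ultrafilter X) (hU : ∀ x, Ici x ∈ U) : U.IsUniform := by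
  refine fun A hA => (mk_set_le A).antisymm (hX.trans (Order.cof_le fun x => ?_))
  obtain ⟨a, hxa, ha⟩ := U.nonempty_of_mem (U.inter_mem (hU x) hA)
  exact ⟨a, ha, hxa⟩

namespace PropAEC

section idx

variable {κ : Cardinal.{u}} (hκ : ℵ₀ ≤ κ)

theorem idx_strictMono : StrictMono (idx hκ) := by
  intro m n h
  simpa [idx, ← Subtype.coe_lt_coe] using h

theorem idx_injective : Function.Injective (idx hκ) :=
  (idx_strictMono hκ).injective

variable {hκ} in
theorem ne_idx_of_lt {m n : ℕ} {i : κ.ord.ToType} (hmn : m < n) (hi : idx hκ n ≤ i) :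
    i ≠ idx hκ m :=
  ((idx_strictMono hκ hmn).trans_le hi).ne'

theorem mk_subtype_idx_le (n : ℕ) : #{i : κ.ord.ToType // idx hκ n ≤ i} = κ := by
  have : Infinite κ.ord.ToType := by rwa [infinite_iff, mk_ord_toType]
  have h := mk_compl_of_infinite (Iio (idx hκ n)) (mk_Iio_lt _ (by simp))
  rwa [mk_ord_toType, compl_Iio] at h

end idx

/-- Sentences over a set `V` of variables, as syntactic objects. The arguments are in the order of
`CodesVar`, `CodesAnd`, `CodesNot` and `CodesConj`: the variable defined by an equivalence comes
first. -/
inductive Sentence {κ : Cardinal.{u}} (hκ : ℵ₀ ≤ κ) (V : Type u) : Type u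
  | var (p : V)
  | and (r p q : V)
  | not (q p : V)
  | conj (q : V) (p : {i : κ.ord.ToType // idx hκ 2 ≤ i} → V)

namespace Sentence

variable {κ : Cardinal.{u}} {hκ : ℵ₀ ≤ κ} {V : Type u}

/-- Truth of a sentence under the truth assignment `v`. -/
def Sat (v : V → Prop) : Sentence hκ V → Prop
  | .var p => v p
  | .and r p q => v r ↔ v p ∧ v q
  | .not q p => v q ↔ ¬ v p
  | .conj q p => v q ↔ ∀ i, v (p i)

/-- The number `n` for which the constant `c_n` marks the form of a sentence. -/
def formIndex : Sentence hκ V → ℕ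
  | .var _ => 0
  | .and _ _ _ => 1
  | .not _ _ => 2
  | .conj _ _ => 3

/-- The sequence `⟨F_i(φ) : i < κ⟩` recording the form and the constituents of a sentence `φ`, with
the constants interpreted by `c`. -/
noncomputable def code (c : κ.ord.ToType → V) (σ : Sentence hκ V) (i : κ.ord.ToType) : V :=
  if i = idx hκ 0 then c (idx hκ σ.formIndex) else
    match σ with
    | .var p => p
    | .and r p q => if i = idx hκ 1 then p else if i = idx hκ 2 then q else r
    | .not q p => if i = idx hκ 1 then p else q
    | .conj q p => if h : idx hκ 2 ≤ i then p ⟨i, h⟩ else q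

section code

variable {c : κ.ord.ToType → V} {i : κ.ord.ToType}

theorem code_zero (σ : Sentence hκ V) : σ.code c (idx hκ 0) = c (idx hκ σ.formIndex) :=
  if_pos rfl

theorem code_var_of_le (p : V) (hi : idx hκ 1 ≤ i) : (var p : Sentence hκ V).code c i = p :=
  if_neg (ne_idx_of_lt one_pos hi)

theorem code_and_one (r p q : V) : (and r p q : Sentence hκ V).code c (idx hκ 1) = p := by
  simp [code, (idx_injective hκ).eq_iff]

theorem code_and_two (r p q : V) : (and r p q : Sentence hκ V).code c (idx hκ 2) = q := by
  simp [code, (idx_injective hκ).eq_iff]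

theorem code_and_of_le (r p q : V) (hi : idx hκ 3 ≤ i) :
    (and r p q : Sentence hκ V).code c i = r := by
  simp [code, ne_idx_of_lt (m := 0) (by norm_num) hi, ne_idx_of_lt (m := 1) (by norm_num) hi,
    ne_idx_of_lt (m := 2) (by norm_num) hi]

theorem code_not_one (q p : V) : (not q p : Sentence hκ V).code c (idx hκ 1) = p := by
  simp [code, (idx_injective hκ).eq_iff]

theorem code_not_of_le (q p : V) (hi : idx hκ 2 ≤ i) :
    (not q p : Sentence hκ V).code c i = q := by
  simp [code, ne_idx_of_lt two_pos hi, ne_idx_of_lt one_lt_two hi]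

theorem code_conj_one (q : V) (p : {i : κ.ord.ToType // idx hκ 2 ≤ i} → V) :
    (conj q p).code c (idx hκ 1) = q := by
  simp [code, (idx_injective hκ).eq_iff, (idx_strictMono hκ).le_iff_le]

theorem code_conj_of_le (q : V) (p : {i : κ.ord.ToType // idx hκ 2 ≤ i} → V)
    (hi : idx hκ 2 ≤ i) : (conj q p).code c i = p ⟨i, hi⟩ := by
  simp [code, ne_idx_of_lt two_pos hi, hi]

theorem formIndex_eq_of_code_zero (hc : Function.Injective c) {σ : Sentence hκ V} {n : ℕ}
    (h : σ.code c (idx hκ 0) = c (idx hκ n)) : σ.formIndex = n :=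
  idx_injective hκ (hc (σ.code_zero.symm.trans h))

theorem code_injective (hc : Function.Injective c) :
    Function.Injective (code c : Sentence hκ V → κ.ord.ToType → V) := by
  intro σ τ h
  have hform : σ.formIndex = τ.formIndex :=
    formIndex_eq_of_code_zero hc ((congrFun h _).trans τ.code_zero)
  have h1 := congrFun h (idx hκ 1)
  have h2 := congrFun h (idx hκ 2)
  have h3 := congrFun h (idx hκ 3)
  cases σ <;> cases τ <;> cases hform
  case var.var => simpa only [code_var_of_le, le_refl, var.injEq] using h1
  case and.and =>
    rw [code_and_one, code_and_one] at h1
    rw [code_and_two, code_and_two] at h2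
    rw [code_and_of_le _ _ _ le_rfl, code_and_of_le _ _ _ le_rfl] at h3
    rw [h1, h2, h3]
  case not.not =>
    rw [code_not_one, code_not_one] at h1
    rw [code_not_of_le _ _ le_rfl, code_not_of_le _ _ le_rfl] at h2
    rw [h1, h2]
  case conj.conj q p q' p' =>
    rw [code_conj_one, code_conj_one] at h1
    have hp : p = p' := funext fun i => by
      simpa only [code_conj_of_le _ _ i.2] using congrFun h i
    rw [h1, hp]

theorem mk_le (hV : κ ≤ #V) : #(Sentence hκ V) ≤ #V ^ κ := by
  obtain ⟨c⟩ : #κ.ord.ToType ≤ #V := by rwa [mk_ord_toType]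
  simpa using mk_le_of_injective (code_injective (hκ := hκ) c.injective)

end code

end Sentence

/-- The propositional variables of the models below: all sets of truth assignments `x : X`, and
`κ` further variables which interpret the constants `c_i`. -/
abbrev PVar (κ : Cardinal.{u}) (X : Type u) : Type u :=
  Set X ⊕ κ.ord.ToType

/-- The truth assignment `x`, under which a set of truth assignments is true iff it contains `x`;
the variables interpreting the constants are false. -/
def TrueAt {κ : Cardinal.{u}} {X : Type u} (x : X) : PVar κ X → Prop :=
  Sum.elim (fun A => x ∈ A) fun _ => False

/-- The universe of the ambient structure: all variables, all sentences, one theory, and the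
principal truth assignments. It is not in `𝔨_κ`, since the theory consists of all sentences. -/
inductive Ambient {κ : Cardinal.{u}} (hκ : ℵ₀ ≤ κ) (X : Type u) : Type u
  | var (p : PVar κ X)
  | sent (σ : Sentence hκ (PVar κ X))
  | thy
  | asg (x : X)

namespace Ambient

variable {κ : Cardinal.{u}} {hκ : ℵ₀ ≤ κ} {X : Type u}

/-- The sort of an element. -/
def kind : Ambient hκ X → Kind
  | .var _ => .P
  | .sent _ => .Γ
  | .thy => .I
  | .asg _ => .J

/-- The interpretation of `F_i`. -/
noncomputable def constituent (i : κ.ord.ToType) : Ambient hκ X → Ambient hκ X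
  | .sent σ => var (σ.code Sum.inr i)
  | y => y

/-- The interpretation of `F_κ`. -/
def theory : Ambient hκ X → Ambient hκ X
  | .asg _ => thy
  | y => y

/-- Truth of a variable or sentence under the truth assignment `x`. -/
def HoldsAt (x : X) : Ambient hκ X → Prop
  | .var p => TrueAt x p
  | .sent σ => σ.Sat (TrueAt x)
  | _ => False

noncomputable instance : (lang κ).Structure (Ambient hκ X) where
  funMap {_} g y := match g, y with
    | .F i, y => (y 0).constituent i
    | .Fκ, y => (y 0).theory
    | .c i, _ => var (.inr i)
  RelMap {_} r y := match r, y with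
    | .kind k, y => (y 0).kind = k
    | .R₁, y => (y 0).kind = .Γ ∧ y 1 = thy
    | .R₂, y => ∃ x, y 1 = asg x ∧ (y 0).HoldsAt x

theorem R₂_iff {y s : Ambient hκ X} : R₂ κ y s ↔ ∃ x, s = asg x ∧ y.HoldsAt x := Iff.rfl

theorem exists_sent_of_is {y : Ambient hκ X} (h : Is κ .Γ y) : ∃ σ, y = sent σ := by
  cases y with
  | sent σ => exact ⟨σ, rfl⟩
  | _ => cases h

theorem eq_thy_of_is {y : Ambient hκ X} (h : Is κ .I y) : y = thy := by
  cases y with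
  | thy => rfl
  | _ => cases h

theorem exists_asg_of_is {y : Ambient hκ X} (h : Is κ .J y) : ∃ x, y = asg x := by
  cases y with
  | asg x => exact ⟨x, rfl⟩
  | _ => cases h

theorem F_of_not_is {y : Ambient hκ X} (h : ¬ Is κ .Γ y) (i : κ.ord.ToType) : F i y = y := by
  cases y with
  | sent σ => exact (h rfl).elim
  | _ => rfl

theorem Fκ_of_not_is {y : Ambient hκ X} (h : ¬ Is κ .J y) : Fκ κ y = y := by
  cases y with
  | asg x => exact (h rfl).elim
  | _ => rfl

theorem existsUnique_is (y : Ambient hκ X) : ∃! k, Is κ k y :=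
  existsUnique_eq'

theorem c_injective : Function.Injective (c (κ := κ) (Ambient hκ X)) := fun _ _ h =>
  Sum.inr_injective (var.inj h)

theorem is_F_of_is {y : Ambient hκ X} (h : Is κ .Γ y) (i : κ.ord.ToType) : Is κ .P (F i y) := by
  obtain ⟨σ, rfl⟩ := exists_sent_of_is h
  rfl

theorem is_Fκ_of_is {y : Ambient hκ X} (h : Is κ .J y) : Is κ .I (Fκ κ y) := by
  obtain ⟨x, rfl⟩ := exists_asg_of_is h
  rfl

theorem is_of_R₁ {y t : Ambient hκ X} (h : R₁ κ y t) : Is κ .Γ y ∧ Is κ .I t :=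
  ⟨h.1, congrArg kind h.2⟩

theorem is_of_R₂ {y s : Ambient hκ X} (h : R₂ κ y s) :
    (Is κ .Γ y ∨ Is κ .P y) ∧ Is κ .J s := by
  obtain ⟨x, hs, hy⟩ := R₂_iff.1 h
  refine ⟨?_, congrArg kind hs⟩
  cases y with
  | sent σ => exact .inl rfl
  | var p => exact .inr rfl
  | _ => cases hy

theorem codesVar_sent (p : PVar κ X) : CodesVar hκ (sent (.var p) : Ambient hκ X) (var p) :=
  ⟨congrArg var (Sentence.code_zero _), fun _ hi => congrArg var (Sentence.code_var_of_le p hi)⟩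

theorem codesAnd_sent (r p q : PVar κ X) :
    CodesAnd hκ (sent (.and r p q) : Ambient hκ X) (var r) (var p) (var q) :=
  ⟨congrArg var (Sentence.code_zero _), congrArg var (Sentence.code_and_one r p q),
    congrArg var (Sentence.code_and_two r p q),
    fun _ hi => congrArg var (Sentence.code_and_of_le r p q hi)⟩

theorem codesNot_sent (q p : PVar κ X) :
    CodesNot hκ (sent (.not q p) : Ambient hκ X) (var q) (var p) :=
  ⟨congrArg var (Sentence.code_zero _), congrArg var (Sentence.code_not_one q p),
    fun _ hi => congrArg var (Sentence.code_not_of_le q p hi)⟩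

theorem codesConj_sent (q : PVar κ X) (p : {i : κ.ord.ToType // idx hκ 2 ≤ i} → PVar κ X) :
    CodesConj hκ (sent (.conj q p) : Ambient hκ X) (var q) (fun i => var (p i)) :=
  ⟨congrArg var (Sentence.code_zero _), congrArg var (Sentence.code_conj_one q p),
    fun i => congrArg var (Sentence.code_conj_of_le q p i.2)⟩

theorem formIndex_eq_of_F_zero {σ : Sentence hκ (PVar κ X)} {n : ℕ}
    (h : F (idx hκ 0) (sent σ) = c (Ambient hκ X) (idx hκ n)) : σ.formIndex = n :=
  Sentence.formIndex_eq_of_code_zero Sum.inr_injective (var.inj h)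

theorem holdsAt_iff_of_codesVar {φ p : Ambient hκ X} {x : X} (hφ : Is κ .Γ φ)
    (h : CodesVar hκ φ p) : φ.HoldsAt x ↔ p.HoldsAt x := by
  obtain ⟨σ, rfl⟩ := exists_sent_of_is hφ
  have hform := formIndex_eq_of_F_zero h.1
  cases σ with
  | var p' =>
    obtain rfl : p = var p' := (h.2 _ le_rfl).symm.trans ((codesVar_sent p').2 _ le_rfl)
    exact Iff.rfl
  | _ => cases hform

theorem holdsAt_iff_of_codesAnd {φ r p q : Ambient hκ X} {x : X} (hφ : Is κ .Γ φ)
    (h : CodesAnd hκ φ r p q) : φ.HoldsAt x ↔ (r.HoldsAt x ↔ p.HoldsAt x ∧ q.HoldsAt x) := by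
  obtain ⟨σ, rfl⟩ := exists_sent_of_is hφ
  have hform := formIndex_eq_of_F_zero h.1
  cases σ with
  | and r' p' q' =>
    have h' := codesAnd_sent (hκ := hκ) r' p' q'
    obtain rfl : r = var r' := (h.2.2.2 _ le_rfl).symm.trans (h'.2.2.2 _ le_rfl)
    obtain rfl : p = var p' := h.2.1.symm.trans h'.2.1
    obtain rfl : q = var q' := h.2.2.1.symm.trans h'.2.2.1
    exact Iff.rfl
  | _ => cases hform

theorem holdsAt_iff_of_codesNot {φ q p : Ambient hκ X} {x : X} (hφ : Is κ .Γ φ)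
    (h : CodesNot hκ φ q p) : φ.HoldsAt x ↔ (q.HoldsAt x ↔ ¬ p.HoldsAt x) := by
  obtain ⟨σ, rfl⟩ := exists_sent_of_is hφ
  have hform := formIndex_eq_of_F_zero h.1
  cases σ with
  | not q' p' =>
    have h' := codesNot_sent (hκ := hκ) q' p'
    obtain rfl : q = var q' := (h.2.2 _ le_rfl).symm.trans (h'.2.2 _ le_rfl)
    obtain rfl : p = var p' := h.2.1.symm.trans h'.2.1
    exact Iff.rfl
  | _ => cases hform

theorem holdsAt_iff_of_codesConj {φ q : Ambient hκ X}
    {p : {i : κ.ord.ToType // idx hκ 2 ≤ i} → Ambient hκ X} {x : X} (hφ : Is κ .Γ φ)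
    (h : CodesConj hκ φ q p) : φ.HoldsAt x ↔ (q.HoldsAt x ↔ ∀ i, (p i).HoldsAt x) := by
  obtain ⟨σ, rfl⟩ := exists_sent_of_is hφ
  have hform := formIndex_eq_of_F_zero h.1
  cases σ with
  | conj q' p' =>
    have h' := codesConj_sent (hκ := hκ) q' p'
    obtain rfl : q = var q' := h.2.1.symm.trans h'.2.1
    obtain rfl : p = fun i => var (p' i) := funext fun i => (h.2.2 i).symm.trans (h'.2.2 i)
    exact Iff.rfl
  | _ => cases hform

theorem sent_form (σ : Sentence hκ (PVar κ X)) :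
    (∃ p, CodesVar hκ (sent σ) p) ∨ (∃ r p q, CodesAnd hκ (sent σ) r p q) ∨
      (∃ q p, CodesNot hκ (sent σ) q p) ∨ ∃ q p, CodesConj hκ (sent σ) q p := by
  cases σ with
  | var p => exact .inl ⟨_, codesVar_sent p⟩
  | and r p q => exact .inr (.inl ⟨_, _, _, codesAnd_sent r p q⟩)
  | not q p => exact .inr (.inr (.inl ⟨_, _, codesNot_sent q p⟩))
  | conj q p => exact .inr (.inr (.inr ⟨_, _, codesConj_sent q p⟩))

theorem mk_le : #(Ambient hκ X) ≤ 2 ^ max κ #X := by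
  have hinf : ℵ₀ ≤ max κ #X := hκ.trans (le_max_left _ _)
  have hinf' : ℵ₀ ≤ (2 : Cardinal.{u}) ^ max κ #X := hinf.trans (cantor _).le
  have hκ' : κ ≤ 2 ^ max κ #X := (le_max_left _ _).trans (cantor _).le
  have hX : #X ≤ 2 ^ max κ #X := (le_max_right _ _).trans (cantor _).le
  have hvar : #(PVar κ X) ≤ 2 ^ max κ #X := by
    simpa using add_le_of_le hinf' (power_le_power_left two_ne_zero (le_max_right κ #X)) hκ'
  have hsent : #(Sentence hκ (PVar κ X)) ≤ 2 ^ max κ #X := calc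
    #(Sentence hκ (PVar κ X)) ≤ #(PVar κ X) ^ κ := Sentence.mk_le (by simp)
    _ ≤ (2 ^ max κ #X) ^ κ := power_le_power_right hvar
    _ = 2 ^ max κ #X := by
      rw [← power_mul, mul_eq_left hinf (le_max_left _ _) (aleph0_pos.trans_le hκ).ne']
  let g : Ambient hκ X → (PVar κ X ⊕ Sentence hκ (PVar κ X)) ⊕ (Option X)
    | .var p => .inl (.inl p)
    | .sent σ => .inl (.inr σ)
    | .thy => .inr none
    | .asg x => .inr (some x)
  have hg : Function.Injective g := by
    rintro (_ | _ | _ | _) (_ | _ | _ | _) h <;> simp_all [g]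
  refine (mk_le_of_injective hg).trans ?_
  simp only [mk_sum, mk_option, lift_id]
  exact add_le_of_le hinf' (add_le_of_le hinf' hvar hsent)
    (add_le_of_le hinf' hX (one_le_aleph0.trans hinf'))

section models

variable {M : Type u} [(lang κ).Structure M] (f : M ↪[lang κ] Ambient hκ X)
include f

theorem R₂_iff_holdsAt {s : M} {x : X} (hs : f s = asg x) (y : M) :
    R₂ κ y s ↔ (f y).HoldsAt x := by
  rw [← R₂_map f, hs, R₂_iff]
  simp only [asg.injEq, exists_eq_left']

theorem exists_forall_R₂_iff_holdsAt {s : M} (hs : Is κ .J s) :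
    ∃ x, ∀ y, R₂ κ y s ↔ (f y).HoldsAt x := by
  obtain ⟨x, hx⟩ := exists_asg_of_is ((is_map f _ _).2 hs)
  exact ⟨x, R₂_iff_holdsAt f hx⟩

theorem form_of_embedding {φ : M} (hφ : Is κ .Γ φ) :
    (∃ p, CodesVar hκ φ p) ∨ (∃ r p q, CodesAnd hκ φ r p q) ∨ (∃ q p, CodesNot hκ φ q p) ∨
      ∃ q p, CodesConj hκ φ q p := by
  obtain ⟨σ, hσ⟩ := exists_sent_of_is ((is_map f _ _).2 hφ)
  have h := (form_iff (f φ)).1 (hσ ▸ sent_form σ)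
  simp only [F_map, codesVar_map, codesAnd_map, codesNot_map, codesConj_map] at h
  exact (form_iff φ).2 h

theorem eq_of_forall_F_eq {φ ψ : M} (hφ : Is κ .Γ φ) (hψ : Is κ .Γ ψ)
    (h : ∀ i, F (κ := κ) i φ = F i ψ) : φ = ψ := by
  obtain ⟨σ, hσ⟩ := exists_sent_of_is ((is_map f _ _).2 hφ)
  obtain ⟨τ, hτ⟩ := exists_sent_of_is ((is_map f _ _).2 hψ)
  have hcode : σ.code Sum.inr = τ.code Sum.inr := funext fun i => by
    have hF : F i (f φ) = F i (f ψ) := by rw [F_map, F_map, h]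
    rw [hσ, hτ] at hF
    exact var.inj hF
  apply f.injective
  rw [hσ, hτ, Sentence.code_injective Sum.inr_injective hcode]

theorem isModel_of_embedding (honto : ∀ t, f t = thy → ∃ s x, f s = asg x)
    (hsat : ∀ φ s σ x, f φ = sent σ → f s = asg x → σ.Sat (TrueAt x)) : IsModel κ hκ M where
  partition y := by simpa only [is_map] using existsUnique_is (f y)
  c_mem i := (is_map f _ _).1 (c_map f i ▸ rfl)
  c_inj := .of_comp (f := f) (by simpa only [Function.comp_def, ← c_map f] using c_injective)
  F_mem i φ hφ := (is_map f _ _).1 (F_map f i φ ▸ is_F_of_is ((is_map f _ _).2 hφ) i)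
  F_off i y hy := f.injective (F_map f i y ▸ F_of_not_is ((is_map f _ _).not.2 hy) i)
  form _ hφ := form_of_embedding f hφ
  ext _ _ hφ hψ h := eq_of_forall_F_eq f hφ hψ h
  R₁_sub φ t h := by simpa only [is_map] using is_of_R₁ ((R₁_map f φ t).2 h)
  R₂_sub y s h := by simpa only [is_map] using is_of_R₂ ((R₂_map f y s).2 h)
  true_var _ _ _ hφ hs h := by
    obtain ⟨x, hx⟩ := exists_forall_R₂_iff_holdsAt f hs
    simpa only [hx] using
      holdsAt_iff_of_codesVar ((is_map f _ _).2 hφ) ((codesVar_map f _ _).2 h)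
  true_and _ _ _ _ _ hφ hs h := by
    obtain ⟨x, hx⟩ := exists_forall_R₂_iff_holdsAt f hs
    simpa only [hx] using
      holdsAt_iff_of_codesAnd ((is_map f _ _).2 hφ) ((codesAnd_map f _ _ _ _).2 h)
  true_not _ _ _ _ hφ hs h := by
    obtain ⟨x, hx⟩ := exists_forall_R₂_iff_holdsAt f hs
    simpa only [hx] using
      holdsAt_iff_of_codesNot ((is_map f _ _).2 hφ) ((codesNot_map f _ _ _).2 h)
  true_conj _ _ _ _ hφ hs h := by
    obtain ⟨x, hx⟩ := exists_forall_R₂_iff_holdsAt f hs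
    simpa only [hx] using
      holdsAt_iff_of_codesConj ((is_map f _ _).2 hφ) ((codesConj_map f _ _ _).2 h)
  Fκ_mem s hs := (is_map f _ _).1 (Fκ_map f s ▸ is_Fκ_of_is ((is_map f _ _).2 hs))
  Fκ_off y hy := f.injective (Fκ_map f y ▸ Fκ_of_not_is ((is_map f _ _).not.2 hy))
  models s φ hs h := by
    obtain ⟨x, hx⟩ := exists_asg_of_is ((is_map f _ _).2 hs)
    obtain ⟨σ, hσ⟩ := exists_sent_of_is (is_of_R₁ ((R₁_map f _ _).2 h)).1
    rw [R₂_iff_holdsAt f hx, hσ]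
    exact hsat φ s σ x hσ hx
  onto t ht := by
    have ht' := eq_thy_of_is ((is_map f _ _).2 ht)
    obtain ⟨s, x, hs⟩ := honto t ht'
    refine ⟨s, (is_map f _ _).1 (hs ▸ rfl), f.injective ?_⟩
    rw [← Fκ_map, hs, ht']
    rfl

end models

/-- Membership of an element in the substructure `sub Φ Y`. -/
def Mem (Φ : Set (Sentence hκ (PVar κ X))) (Y : Set X) : Ambient hκ X → Prop
  | .var _ => True
  | .sent σ => σ ∈ Φ
  | .thy => Y.Nonempty
  | .asg x => x ∈ Y

section sub

variable (Φ : Set (Sentence hκ (PVar κ X))) (Y : Set X)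

variable {Φ Y} in
theorem mem_constituent {y : Ambient hκ X} (hy : y.Mem Φ Y) (i : κ.ord.ToType) :
    (y.constituent i).Mem Φ Y := by
  cases y with
  | sent σ => trivial
  | _ => exact hy

variable {Φ Y} in
theorem mem_theory {y : Ambient hκ X} (hy : y.Mem Φ Y) : y.theory.Mem Φ Y := by
  cases y with
  | asg x => exact ⟨x, hy⟩
  | _ => exact hy

/-- The substructure of the ambient structure with all variables, the sentences in `Φ`, the
principal truth assignments in `Y` and, if there are any, the theory. -/
def sub : (lang κ).Substructure (Ambient hκ X) where
  carrier := {y | y.Mem Φ Y}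
  fun_mem g y hy := by
    cases g with
    | F i => exact mem_constituent (hy 0) i
    | Fκ => exact mem_theory (hy 0)
    | c i => trivial

variable {Φ Y} {Φ' : Set (Sentence hκ (PVar κ X))} {Y' : Set X}

theorem sub_mono (hΦ : Φ ⊆ Φ') (hY : Y ⊆ Y') : sub Φ Y ≤ sub Φ' Y' := by
  intro y hy
  cases y with
  | var p => trivial
  | sent σ => exact hΦ hy
  | thy => exact Nonempty.mono hY hy
  | asg x => exact hY hy

theorem isModel_sub (h : ∀ σ ∈ Φ, ∀ x ∈ Y, σ.Sat (TrueAt x)) : IsModel κ hκ (sub Φ Y) := by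
  refine isModel_of_embedding (sub Φ Y).subtype ?_ ?_
  · rintro ⟨t, ht⟩ rfl
    obtain ⟨x, hx⟩ : Y.Nonempty := ht
    exact ⟨⟨asg x, hx⟩, x, rfl⟩
  · rintro ⟨φ, hφ⟩ ⟨s, hs⟩ σ x rfl rfl
    exact h σ hφ x hs

theorem isModel_sub_empty : IsModel κ hκ (sub Φ ∅) :=
  isModel_sub fun _ _ _ hx => hx.elim

theorem is_Γ_sent {σ : Sentence hκ (PVar κ X)} (hσ : σ ∈ Φ) :
    Is κ .Γ (⟨sent σ, hσ⟩ : sub Φ Y) :=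
  (is_map (sub Φ Y).subtype .Γ ⟨sent σ, hσ⟩).1 rfl

theorem R₂_sent_iff {N : Type u} [(lang κ).Structure N] (hN : IsModel κ hκ N)
    (g : sub Φ Y ↪[lang κ] N) {s : N} (hs : Is κ .J s) {σ : Sentence hκ (PVar κ X)}
    (hσ : σ ∈ Φ) :
    R₂ κ (g ⟨sent σ, hσ⟩) s ↔ σ.Sat fun p => R₂ κ (g ⟨var p, trivial⟩) s := by
  have hΓ := (is_map g _ _).2 (is_Γ_sent hσ)
  cases σ with
  | var p =>
    exact hN.true_var _ _ _ hΓ hs <| (codesVar_map g _ ⟨var p, trivial⟩).2 <|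
      (codesVar_map (sub Φ Y).subtype _ _).1 (codesVar_sent p)
  | and r p q =>
    exact hN.true_and _ _ _ _ _ hΓ hs <|
      (codesAnd_map g _ ⟨var r, trivial⟩ ⟨var p, trivial⟩ ⟨var q, trivial⟩).2 <|
      (codesAnd_map (sub Φ Y).subtype _ _ _ _).1 (codesAnd_sent r p q)
  | not q p =>
    exact hN.true_not _ _ _ _ hΓ hs <|
      (codesNot_map g _ ⟨var q, trivial⟩ ⟨var p, trivial⟩).2 <|
      (codesNot_map (sub Φ Y).subtype _ _ _).1 (codesNot_sent q p)
  | conj q p =>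
    exact hN.true_conj _ _ _ _ hΓ hs <|
      (codesConj_map g _ ⟨var q, trivial⟩ fun i => ⟨var (p i), trivial⟩).2 <|
      (codesConj_map (sub Φ Y).subtype _ _ _).1 (codesConj_sent q p)

end sub

end Ambient

section fullTheory

variable {κ : Cardinal.{u}} {hκ : ℵ₀ ≤ κ} {M : Type u} [(lang κ).Structure M]

/-- The tuple of `x` is a theory containing all sentences of `M`. -/
def RealizesFullTheory (x : (frakK κ hκ).PointedExt M) : Prop :=
  ∃ t, x.tuple = [t] ∧ Is κ .I t ∧ ∀ φ : M, Is κ .Γ φ → R₁ κ (x.emb φ) t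

theorem realizesFullTheory_iff_of_step {x y : (frakK κ hκ).PointedExt M}
    (h : (frakK κ hκ).Step x y) : RealizesFullTheory x ↔ RealizesFullTheory y := by
  obtain ⟨g, -, hg, hxy⟩ := h
  have hR : ∀ φ t, R₁ κ (y.emb φ) (g t) ↔ R₁ κ (x.emb φ) t := fun φ t => by
    rw [← hg, ← R₁_map g]
    rfl
  constructor
  · rintro ⟨t, ht, hI, hall⟩
    exact ⟨g t, by rw [← hxy, ht, List.map_singleton], (is_map g _ _).2 hI,
      fun φ hφ => (hR φ t).2 (hall φ hφ)⟩
  · rintro ⟨t', ht', hI, hall⟩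
    obtain ⟨t, ht, rfl⟩ := List.map_eq_singleton_iff.1 (hxy.trans ht')
    exact ⟨t, ht, (is_map g _ _).1 hI, fun φ hφ => (hR φ t).1 (hall φ hφ)⟩

/-- `q` is the type over `M` of a theory containing all sentences of `M`. -/
def IsFullTheory : (frakK κ hκ).FinType M → Prop :=
  Quot.lift RealizesFullTheory fun _ _ h => propext (realizesFullTheory_iff_of_step h)

theorem isFullTheory_tp {x : (frakK κ hκ).PointedExt M} :
    IsFullTheory ((frakK κ hκ).tp x) ↔ RealizesFullTheory x := Iff.rfl

theorem isFullTheory_of_forall_restrict {δ : Ordinal.{u}} (hδ : Order.IsSuccLimit δ)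
    (C : (frakK κ hκ).Chain δ) (q : (frakK κ hκ).FinType (C.model δ le_rfl))
    (hq : ∀ (i : Ordinal.{u}) (hi : i < δ), IsFullTheory (C.restrict hi.le le_rfl q)) :
    IsFullTheory q := by
  obtain ⟨x, rfl⟩ := Quot.exists_rep q
  obtain ⟨t, ht, hI, -⟩ := isFullTheory_tp.1 (hq ⊥ hδ.bot_lt)
  refine ⟨t, ht, hI, fun φ hφ => ?_⟩
  obtain ⟨⟨i, hi⟩, hiδ, hφi⟩ := C.continuous ⟨δ, mem_Iic.2 le_rfl⟩ hδ φ φ.2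
  obtain ⟨t', ht', -, hall⟩ := isFullTheory_tp.1 (hq i hiδ)
  obtain rfl : t' = t := List.singleton_injective (ht'.symm.trans ht)
  exact hall ⟨φ, hφi⟩ ((is_map (Substructure.inclusion (C.sub.monotone hi)) _ _).1 hφ)

end fullTheory

namespace Ambient

section types

variable {κ : Cardinal.{u}} {hκ : ℵ₀ ≤ κ} {X : Type u} {Φ Φ' : Set (Sentence hκ (PVar κ X))}
  {Y Y' : Set X}

theorem exists_sat_of_isFullTheory {q : (frakK κ hκ).FinType (sub Φ Y)} (hq : IsFullTheory q) :
    ∃ v : PVar κ X → Prop, ∀ σ ∈ Φ, σ.Sat v := by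
  obtain ⟨x, rfl⟩ := Quot.exists_rep q
  obtain ⟨t, -, hI, hall⟩ := isFullTheory_tp.1 hq
  have hN : IsModel κ hκ x.carrier := x.strong.2
  obtain ⟨s, hs, rfl⟩ := hN.onto t hI
  exact ⟨_, fun σ hσ => (R₂_sent_iff hN x.emb hs hσ).1
    (hN.models s _ hs (hall _ (is_Γ_sent hσ)))⟩

/-- The extension of `sub Φ ∅` by the principal truth assignments in `Y`, pointed at the theory
consisting of all sentences. -/
noncomputable def pointedExt (h : ∀ σ ∈ Φ, ∀ x ∈ Y, σ.Sat (TrueAt x)) (hY : Y.Nonempty) :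
    (frakK κ hκ).PointedExt (sub Φ ∅) where
  carrier := sub Φ Y
  emb := Substructure.inclusion (sub_mono subset_rfl (empty_subset Y))
  strong := ⟨isModel_sub_empty, isModel_sub h⟩
  tuple := [⟨thy, hY⟩]

theorem isFullTheory_tp_pointedExt (h : ∀ σ ∈ Φ, ∀ x ∈ Y, σ.Sat (TrueAt x)) (hY : Y.Nonempty) :
    IsFullTheory ((frakK κ hκ).tp (pointedExt h hY)) := by
  refine ⟨_, rfl, (is_map (sub Φ Y).subtype .I ⟨thy, hY⟩).1 rfl, fun φ hφ => ?_⟩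
  exact (R₁_map (sub Φ Y).subtype _ _).1 ⟨(is_map (sub Φ ∅).subtype .Γ φ).2 hφ, rfl⟩

theorem tp_pointedExt_of_subset (h : ∀ σ ∈ Φ, ∀ x ∈ Y, σ.Sat (TrueAt x)) (hY : Y.Nonempty)
    (hYY' : Y ⊆ Y') (h' : ∀ σ ∈ Φ, ∀ x ∈ Y', σ.Sat (TrueAt x)) :
    (frakK κ hκ).tp (pointedExt h' (hY.mono hYY')) = (frakK κ hκ).tp (pointedExt h hY) :=
  .symm <| Quot.sound ⟨Substructure.inclusion (sub_mono subset_rfl hYY'),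
    ⟨isModel_sub h, isModel_sub h'⟩, rfl, rfl⟩

theorem tp_pointedExt_eq_restrict (hΦ : Φ ⊆ Φ') (h : ∀ σ ∈ Φ', ∀ x ∈ Y, σ.Sat (TrueAt x))
    (hY : Y.Nonempty) :
    (frakK κ hκ).tp (pointedExt (fun σ hσ => h σ (hΦ hσ)) hY) =
      (frakK κ hκ).restrict (Substructure.inclusion (sub_mono hΦ subset_rfl))
        ⟨isModel_sub_empty, isModel_sub_empty⟩ ((frakK κ hκ).tp (pointedExt h hY)) :=
  Quot.sound ⟨Substructure.inclusion (sub_mono hΦ subset_rfl),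
    ⟨isModel_sub fun σ hσ => h σ (hΦ hσ), isModel_sub h⟩, rfl, rfl⟩

end types

section chain

variable {κ : Cardinal.{u}} {hκ : ℵ₀ ≤ κ} {δ i j : Ordinal.{u}}

variable (hκ δ) in
/-- The sentences true at all principal truth assignments `x ≥ k`, for some `k < i`. -/
def trueBefore (i : Ordinal.{u}) : Set (Sentence hκ (PVar κ δ.ToType)) :=
  {σ | ∃ k : δ.ToType, (k : Ordinal.{u}) < i ∧ ∀ x, k ≤ x → σ.Sat (TrueAt x)}

variable (δ) in
/-- The final segment `[i, δ)`. -/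
def tail (i : Ordinal.{u}) : Set δ.ToType :=
  {x | i ≤ (x : Ordinal.{u})}

theorem trueBefore_mono : Monotone (trueBefore hκ δ) := fun _ _ hij _ hσ =>
  hσ.imp fun _ hk => ⟨hk.1.trans_le hij, hk.2⟩

theorem tail_anti : Antitone (tail δ) := fun _ _ hij _ hx => hij.trans hx

theorem tail_nonempty (hi : i < δ) : (tail δ i).Nonempty :=
  ⟨Ordinal.ToType.mk ⟨i, hi⟩, by simp [tail]⟩

theorem sat_of_mem_trueBefore (σ : Sentence hκ (PVar κ δ.ToType)) (hσ : σ ∈ trueBefore hκ δ i)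
    (x : δ.ToType) (hx : x ∈ tail δ i) : σ.Sat (TrueAt x) := by
  obtain ⟨k, hki, hk⟩ := hσ
  exact hk x (by simpa using (hki.trans_le hx).le)

theorem var_Ici_mem_trueBefore (k : δ.ToType) :
    Sentence.var (.inl (Ici k)) ∈ trueBefore hκ δ δ :=
  ⟨k, (Ordinal.ToType.toOrd k).2, fun _ hx => hx⟩

theorem mem_trueBefore_of_forall_sat (hδ : 0 < δ) {σ : Sentence hκ (PVar κ δ.ToType)}
    (hσ : ∀ x, σ.Sat (TrueAt x)) : σ ∈ trueBefore hκ δ δ :=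
  ⟨Ordinal.ToType.mk ⟨0, hδ⟩, (Ordinal.ToType.toOrd _).2, fun x _ => hσ x⟩

variable (hκ δ) in
/-- The chain of the models `M_i` whose elements are all variables and the sentences in
`trueBefore hκ δ i`. -/
noncomputable def chain : (frakK κ hκ).Chain δ where
  carrier := Ambient hκ δ.ToType
  sub := ⟨fun i => sub (trueBefore hκ δ i) ∅, fun _ _ h => sub_mono (trueBefore_mono h) subset_rfl⟩
  strong _ _ _ := ⟨isModel_sub_empty, isModel_sub_empty⟩
  continuous i hi y hy := by
    cases y with
    | var p => exact ⟨⟨⊥, mem_Iic.2 bot_le⟩, hi.bot_lt, trivial⟩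
    | sent σ =>
      obtain ⟨k, hki, hk⟩ : σ ∈ trueBefore hκ δ i := hy
      have hsucc := hi.succ_lt hki
      exact ⟨⟨_, hsucc.le.trans i.2⟩, hsucc, k, Order.lt_succ _, hk⟩
    | thy => exact (not_nonempty_empty hy).elim
    | asg x => exact hy.elim

theorem tp_pointedExt_eq_chain_restrict (hij : i ≤ j) (hj : j < δ) :
    (frakK κ hκ).tp (pointedExt sat_of_mem_trueBefore (tail_nonempty (hij.trans_lt hj))) =
      (chain hκ δ).restrict hij hj.le
        ((frakK κ hκ).tp (pointedExt sat_of_mem_trueBefore (tail_nonempty hj))) :=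
  (tp_pointedExt_of_subset (fun σ hσ x hx => sat_of_mem_trueBefore σ hσ x (tail_anti hij hx)) _
    (tail_anti hij) _).trans
      (tp_pointedExt_eq_restrict (trueBefore_mono hij) sat_of_mem_trueBefore (tail_nonempty hj))

end chain

theorem exists_ultrafilter_of_forall_sat {κ : Cardinal.{u}} {hκ : ℵ₀ ≤ κ} {X : Type u}
    (v : PVar κ X → Prop)
    (hv : ∀ σ : Sentence hκ (PVar κ X), (∀ x, σ.Sat (TrueAt x)) → σ.Sat v) :
    ∃ U : Ultrafilter X, (∀ A, A ∈ U ↔ v (.inl A)) ∧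
      CardinalInterFilter (U : Filter X) (Order.succ κ) := by
  have hmk := mk_subtype_idx_le hκ 2
  have : Infinite {i : κ.ord.ToType // idx hκ 2 ≤ i} := by rwa [infinite_iff, hmk]
  have hcompl : ∀ A : Set X, v (.inl Aᶜ) ↔ ¬ v (.inl A) := fun A =>
    hv (.not (.inl Aᶜ) (.inl A)) fun _ => Iff.rfl
  have hiInter : ∀ A : {i : κ.ord.ToType // idx hκ 2 ≤ i} → Set X,
      v (.inl (⋂ i, A i)) ↔ ∀ i, v (.inl (A i)) := fun A =>
    hv (.conj (.inl (⋂ i, A i)) fun i => .inl (A i)) fun _ => mem_iInter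
  have hU := exists_ultrafilter_cardinalInterFilter_of_iInter_mem_iff {A | v (.inl A)} hcompl
    hiInter
  rwa [hmk] at hU

end Ambient

end PropAEC

open PropAEC PropAEC.Ambient in
theorem mainTheorem6_general (κ θ lam : Cardinal.{u}) (hκ : ℵ₀ ≤ κ) (hθ : θ.IsRegular)
    (hD : ¬ ∃ D : Ultrafilter θ.ord.ToType,
      D.IsUniform ∧ CardinalInterFilter (D : Filter θ.ord.ToType) (Order.succ κ))
    (hlam : 2 ^ max κ θ ≤ lam) :
    ¬ (PropAEC.frakK κ hκ).IsCompactForTypes lam θ := by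
  intro hcompact
  obtain ⟨q, hq⟩ := hcompact (chain hκ θ.ord)
    (fun _ _ => (mk_subtype_le _).trans (mk_le.trans (by rwa [mk_ord_toType])))
    (fun _ hi => (frakK κ hκ).tp (pointedExt sat_of_mem_trueBefore (tail_nonempty hi)))
    fun _ _ hij hj => tp_pointedExt_eq_chain_restrict hij.le hj
  have hfull : IsFullTheory q := isFullTheory_of_forall_restrict (isSuccLimit_ord hθ.aleph0_le)
    (chain hκ θ.ord) q fun i hi => hq i hi ▸ isFullTheory_tp_pointedExt _ _
  obtain ⟨v, hv⟩ := exists_sat_of_isFullTheory hfull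
  obtain ⟨U, hU, hUκ⟩ := exists_ultrafilter_of_forall_sat v fun σ hσ =>
    hv σ (mem_trueBefore_of_forall_sat hθ.ord_pos hσ)
  have hcof : #θ.ord.ToType ≤ Order.cof θ.ord.ToType := by
    rw [mk_ord_toType, Ordinal.cof_toType, hθ.cof_ord]
  exact hD ⟨U, isUniform_of_forall_Ici_mem hcof U fun k =>
    (hU _).2 (hv _ (var_Ici_mem_trueBefore k)), hUκ⟩

theorem mainTheorem6 (κ θ lam : Cardinal.{u}) (hκ : ℵ₀ ≤ κ) (hθ : θ.IsRegular) (hκθ : κ < θ)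
    (hD : ¬ ∃ D : Ultrafilter θ.ord.ToType,
      D.IsUniform ∧ CardinalInterFilter (D : Filter θ.ord.ToType) (Order.succ κ))
    (hlam : lam = 2 ^ θ) :
    ¬ (PropAEC.frakK κ hκ).IsCompactForTypes lam θ :=
  mainTheorem6_general κ θ lam hκ hθ hD (by rw [hlam, max_eq_right hκθ.le])
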